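/- \textbf{Conventions.} Let $R$ be a commutative ring, $S$ a module-finite $R$-algebra (not necessarily commutative), $M$ a right $S$-module, and $N$ a finitely presented right $S$-module. Right $S$-modules are viewed as $R$-modules through $R\to S$, and a subscript $\mathfrak p$ denotes localization at $R\setminus\mathfrak p$. A linear map is \emph{split surjective} if it has a linear right inverse. For right $S$-modules $A,B$ and an $R$-submodule $H\subseteq\operatorname{Hom}_S(A,B)$, a tuple in $H^{\oplus t}$ is viewed as an $S$-linear map $A\to B^{\oplus t}$. Let $\delta(H)\in\{0,1,\dots,\infty\}$ be the supremum of the integers $t\ge 0$ such that some $h\in H^{\oplus t}$ is split surjective over $S$; for $\mathfrak p\in\operatorname{Spec}(R)$, let $\delta_{\mathfrak p}(H)$ be the supremum of the integers $t\ge 0$ such that, for some $h\in H^{\oplus t}$, the map $h_{\mathfrak p}$ is split surjective over $S_{\mathfrak p}$. Subsets of $\operatorname{Spec}(R)$ carry the subspace topology of the Zariski topology, and $\dim$ is the topological Krull dimension, with $\dim(\varnothing)=-\infty$. A set $X\subseteq\operatorname{Spec}(R)$ is a \emph{basic set for $R$} if $X$ is a Noetherian space and every $\mathfrak p\in\operatorname{Spec}(R)$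 that is an intersection of members of $X$ belongs to $X$. For $\mathfrak p\in X$, let $\dim_X(\mathfrak p)$ be the Krull dimension of $\{\mathfrak q\in X:\mathfrak p\subseteq\mathfrak q\}$. \textbf{Theorem.} Let $L$ be an $S$-submodule of $M$, let $F$ be a finitely generated $R$-submodule of $\operatorname{Hom}_S(L,N)$, and let $G$ be an $R$-submodule of $\operatorname{Hom}_S(M,N)$. Suppose that every member of $F$ can be extended to a member of $G$. Let $X\subseteq\operatorname{Supp}_R(N)$ be a basic set for $R$ with $\dim(X)<\infty$. Then: (1) Let $t$ be a positive integer, and suppose that $\delta_{\mathfrak p}(F)\ge t+\dim_X(\mathfrak p)$ for every $\mathfrak p\in X$. Then there exists $g\in G^{\oplus t}$ such that $g_{\mathfrak p}$ is split surjective over $S_{\mathfrak p}$ for every $\mathfrak p\in X$. (2) Suppose that $\operatorname{Max}(R)\cap\operatorname{Supp}_R(N)\subseteq X$. Then \[ \delta(G)\ \ge\ \inf\{\delta_{\mathfrak p}(F)-\dim_X(\mathfrak p):\mathfrak p\in X\}, \] where the infimum is taken in the extended real numbers (so it is $\infty$ if $X=\varnothing$). -/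

import Mathlib

noncomputable section

namespace SplittingCapacity

open MulOpposite TopologicalSpace
open scoped ENNReal

/-! Right modules over a ring `S` are modules over `Sᵐᵒᵖ`. -/

section Localization

variable {R : Type*} [CommRing R] {S : Type*} [Ring S] [Algebra R S]
  {M : Type*} [AddCommGroup M] [Module R M] [Module Sᵐᵒᵖ M] [IsScalarTower R Sᵐᵒᵖ M]
  {N : Type*} [AddCommGroup N] [Module R N] [Module Sᵐᵒᵖ N] [IsScalarTower R Sᵐᵒᵖ N]
  (P : Submonoid R)

lemma op_smul_smul (r : R) (x : S) (m : M) : op x • r • m = r • op x • m :=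
  smul_comm (op x) r m

lemma op_smul_left (r : R) (x : S) (m : M) : op (r • x) • m = r • op x • m := by
  rw [op_smul, smul_assoc]

/-- The right action of the ring `P⁻¹S` on `P⁻¹M`: `(m / b) · (x / a) = (m · x) / (a b)`. -/
def rightMul (x : LocalizedModule P S) (m : LocalizedModule P M) : LocalizedModule P M :=
  x.liftOn
    (fun p => m.liftOn (fun q => LocalizedModule.mk (op p.1 • q.1) (p.2 * q.2))
      (by
        rintro ⟨m, b⟩ ⟨m', b'⟩ ⟨v, hv⟩
        rw [LocalizedModule.mk_eq]
        refine ⟨v, ?_⟩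
        have hv' := congrArg (fun z : M => op p.1 • (p.2 : R) • z) hv
        simp only [Submonoid.smul_def, Submonoid.coe_mul, op_smul_smul, smul_smul] at hv' ⊢
        refine Eq.trans ?_ (hv'.trans ?_) <;> (congr 1; ring)))
    (by
      rintro ⟨x, a⟩ ⟨x', a'⟩ ⟨u, hu⟩
      induction m using LocalizedModule.induction_on with
      | h m b =>
        simp only [LocalizedModule.liftOn_mk]
        rw [LocalizedModule.mk_eq]
        refine ⟨u, ?_⟩
        have hu' := congrArg (fun z : S => op z • (b : R) • m) hu
        simp only [Submonoid.smul_def, Submonoid.coe_mul, op_smul_smul, op_smul_left,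
          smul_smul] at hu' ⊢
        refine Eq.trans ?_ (hu'.trans ?_) <;> (congr 1; ring))

lemma rightMul_mk (x : S) (m : M) (a b : P) :
    rightMul P (LocalizedModule.mk x a) (LocalizedModule.mk m b)
      = LocalizedModule.mk (op x • m) (a * b) := rfl

/-- `P⁻¹M` is a right `P⁻¹S`-module. -/
instance rightModule : Module (LocalizedModule P S)ᵐᵒᵖ (LocalizedModule P M) where
  smul x m := rightMul P (unop x) m
  one_smul m := by
    induction m using LocalizedModule.induction_on with
    | h m b =>
      change rightMul P (1 : LocalizedModule P S) (LocalizedModule.mk m b) = _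
      have h1 : (1 : LocalizedModule P S) = LocalizedModule.mk 1 1 :=
        OreLocalization.one_def
      rw [h1, rightMul_mk, op_one, one_smul, one_mul]
  mul_smul x y m := by
    induction x using MulOpposite.rec' with | h x =>
    induction y using MulOpposite.rec' with | h y =>
    induction x, y using LocalizedModule.induction_on₂ with
    | h x y a c =>
    induction m using LocalizedModule.induction_on with
    | h m b =>
      change rightMul P (LocalizedModule.mk y c * LocalizedModule.mk x a) _
        = rightMul P (LocalizedModule.mk x a) (rightMul P (LocalizedModule.mk y c) _)
      rw [LocalizedModule.mk_mul_mk, rightMul_mk, rightMul_mk, rightMul_mk, op_mul, mul_smul,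
        mul_comm c a, mul_assoc]
  smul_zero x := by
    induction x using MulOpposite.rec' with | h x =>
    induction x using LocalizedModule.induction_on with
    | h x a =>
      change rightMul P (LocalizedModule.mk x a) 0 = 0
      rw [← LocalizedModule.zero_mk 1, rightMul_mk, smul_zero, LocalizedModule.zero_mk,
        LocalizedModule.zero_mk]
  smul_add x m n := by
    induction x using MulOpposite.rec' with | h x =>
    induction x using LocalizedModule.induction_on with
    | h x a =>
    induction m, n using LocalizedModule.induction_on₂ with
    | h m n b c =>
      change rightMul P (LocalizedModule.mk x a) (LocalizedModule.mk m b + LocalizedModule.mk n c)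
        = rightMul P (LocalizedModule.mk x a) (LocalizedModule.mk m b)
          + rightMul P (LocalizedModule.mk x a) (LocalizedModule.mk n c)
      rw [LocalizedModule.mk_add_mk, rightMul_mk, rightMul_mk, rightMul_mk,
        LocalizedModule.mk_add_mk, LocalizedModule.mk_eq]
      refine ⟨1, ?_⟩
      simp only [Submonoid.smul_def, Submonoid.coe_mul, smul_add, op_smul_smul, smul_smul]
      congr 1 <;> (congr 1; ring)
  add_smul x y m := by
    induction x using MulOpposite.rec' with | h x =>
    induction y using MulOpposite.rec' with | h y =>
    induction x, y using LocalizedModule.induction_on₂ with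
    | h x y a c =>
    induction m using LocalizedModule.induction_on with
    | h m b =>
      change rightMul P (LocalizedModule.mk x a + LocalizedModule.mk y c) (LocalizedModule.mk m b)
        = rightMul P (LocalizedModule.mk x a) (LocalizedModule.mk m b)
          + rightMul P (LocalizedModule.mk y c) (LocalizedModule.mk m b)
      rw [LocalizedModule.mk_add_mk, rightMul_mk, rightMul_mk, rightMul_mk,
        LocalizedModule.mk_add_mk, LocalizedModule.mk_eq]
      refine ⟨1, ?_⟩
      simp only [Submonoid.smul_def, Submonoid.coe_mul, op_add, add_smul, op_smul_left, smul_add,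
        smul_smul]
      congr 1 <;> (congr 1; ring)
  zero_smul m := by
    induction m using LocalizedModule.induction_on with
    | h m b =>
      change rightMul P 0 (LocalizedModule.mk m b) = 0
      rw [← LocalizedModule.zero_mk 1, rightMul_mk, op_zero, zero_smul, LocalizedModule.zero_mk]

lemma op_mk_smul_mk (x : S) (m : M) (a b : P) :
    op (LocalizedModule.mk x a) • LocalizedModule.mk m b
      = LocalizedModule.mk (op x • m) (a * b) := rfl

/-- The localization `P⁻¹f : P⁻¹M → P⁻¹N` of a map `f` of right `S`-modules, as a map of right
`P⁻¹S`-modules: `m / b ↦ f m / b`. -/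
def localizedMap (f : M →ₗ[Sᵐᵒᵖ] N) :
    LocalizedModule P M →ₗ[(LocalizedModule P S)ᵐᵒᵖ] LocalizedModule P N where
  toFun := LocalizedModule.map P (f.restrictScalars R)
  map_add' := map_add _
  map_smul' x m := by
    induction x using MulOpposite.rec' with | h x =>
    induction x using LocalizedModule.induction_on with
    | h x a =>
    induction m using LocalizedModule.induction_on with
    | h m b =>
      simp [op_mk_smul_mk, LocalizedModule.map_mk]

lemma localizedMap_mk (f : M →ₗ[Sᵐᵒᵖ] N) (m : M) (b : P) :
    localizedMap P f (LocalizedModule.mk m b) = LocalizedModule.mk (f m) b :=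
  LocalizedModule.map_mk P (f.restrictScalars R) m b

end Localization

/-- A linear map is split surjective if it has a linear section. -/
def IsSplitSurjective {A : Type*} [Ring A] {M N : Type*} [AddCommGroup M] [AddCommGroup N]
    [Module A M] [Module A N] (f : M →ₗ[A] N) : Prop :=
  ∃ s : N →ₗ[A] M, f ∘ₗ s = LinearMap.id

section Capacity

variable {R : Type*} [CommRing R] {S : Type*} [Ring S] [Algebra R S]
  {M : Type*} [AddCommGroup M] [Module R M] [Module Sᵐᵒᵖ M] [IsScalarTower R Sᵐᵒᵖ M]
  {N : Type*} [AddCommGroup N] [Module R N] [Module Sᵐᵒᵖ N] [IsScalarTower R Sᵐᵒᵖ N]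

/-- `f_p : M_p → N_p` is split surjective over `S_p`. -/
def IsSplitSurjectiveAt (p : PrimeSpectrum R) (f : M →ₗ[Sᵐᵒᵖ] N) : Prop :=
  IsSplitSurjective (localizedMap p.asIdeal.primeCompl f)

/-- `δ(F)`: the supremum of the `t` such that some `f = (f₁, …, f_t) ∈ F^t`, viewed as a map
`M → N^t`, is split surjective over `S`. -/
def delta (F : Submodule R (M →ₗ[Sᵐᵒᵖ] N)) : ℕ∞ :=
  ⨆ t ∈ {t : ℕ | ∃ f : Fin t → (M →ₗ[Sᵐᵒᵖ] N),
    (∀ i, f i ∈ F) ∧ IsSplitSurjective (LinearMap.pi f)}, (t : ℕ∞)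

/-- `δ_p(F)`: the supremum of the `t` such that some `f = (f₁, …, f_t) ∈ F^t`, viewed as a map
`M → N^t`, has the property that `f_p` is split surjective over `S_p`. -/
def deltaAt (p : PrimeSpectrum R) (F : Submodule R (M →ₗ[Sᵐᵒᵖ] N)) : ℕ∞ :=
  ⨆ t ∈ {t : ℕ | ∃ f : Fin t → (M →ₗ[Sᵐᵒᵖ] N),
    (∀ i, f i ∈ F) ∧ IsSplitSurjectiveAt p (LinearMap.pi f)}, (t : ℕ∞)

end Capacity

/-- A basic set for `R`: a Noetherian subspace of `Spec R` that contains every prime which is an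
intersection of members of the set. -/
structure IsBasicSet {R : Type*} [CommRing R] (X : Set (PrimeSpectrum R)) : Prop where
  noetherian : NoetherianSpace X
  mem_of_eq_sInf : ∀ (p : PrimeSpectrum R) (Y : Set (PrimeSpectrum R)), Y ⊆ X →
    p.asIdeal = sInf (PrimeSpectrum.asIdeal '' Y) → p ∈ X

/-- `dim_X(p)`: the Krull dimension of the subspace `V(p) ∩ X` of `Spec R`. -/
def dimAt {R : Type*} [CommRing R] (X : Set (PrimeSpectrum R)) (p : PrimeSpectrum R) :
    WithBot ℕ∞ :=
  topologicalKrullDim ↥(PrimeSpectrum.zeroLocus (p.asIdeal : Set R) ∩ X)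

/-- The inclusion of `{-∞, 0, 1, …, ∞}` into the extended reals. -/
def toExt : WithBot ℕ∞ → EReal :=
  WithBot.recBotCoe ⊥ (fun n : ℕ∞ => ((n : ℝ≥0∞) : EReal))

end SplittingCapacity

end

noncomputable section

namespace SplittingCapacity

open MulOpposite TopologicalSpace
open scoped ENNReal TensorProduct

/-! Splitting is measured by `splitIdeal h`, the ideal of scalars `σ` for which `σ • id` factors
through `h`. As `N` is finitely presented over `S` and finite over `R`, `h_p` is split surjective
exactly when this ideal is not inside `p`. Hence splitting is an open condition on `p`, it can be
tested on the residue fibre for endomorphisms, and it is global once it holds at all maximal ideals.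

The core (`exists_tuple_succ`) is a basic-element argument that lowers the number of generators of
`F` to `t`. From `n + 1` generators one passes to the `n` elements `f i + a i • g`, keeping `min n
(t + dim_X p)` split elements at each `p ∈ X`. Losing one generator costs at most one split element
(`HasSplitTuple.of_le_sup_span_singleton`), so only those `p` matter where `t + dim_X p ≤ n` and
there is no surplus. A strictly smaller prime of `X` has larger dimension, hence a surplus, so such
`p` are minimal points of `X` in a closed set, and they are finite in number
(`IsBasicSet.finite_minimal`). At such a `p` the split tuple is given by a matrix with fewer rows
than columns. A kernel vector modulo `p` lets the new generators recover the split tuple, up to an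
error that a generic choice of `a` makes harmless (`exists_smul_add_splitIdeal_not_le`). One `a`
serves all bad primes by `exists_forall_of_finset_primes`.

The resulting tuple in `F` extends to `G`, and a section through `L` is a section through `M`. -/

lemma exists_common_multiple {R ι : Type*} [CommRing R] [Finite ι] (T : Submonoid R)
    (Q : ι → R → Prop) (hQ : ∀ i σ r, Q i σ → Q i (r * σ)) (h : ∀ i, ∃ σ ∈ T, Q i σ) :
    ∃ σ ∈ T, ∀ i, Q i σ := by
  classical
  cases nonempty_fintype ι
  choose σ hT hσ using h
  refine ⟨∏ i, σ i, T.prod_mem fun i _ => hT i, fun i => ?_⟩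
  rw [← Finset.prod_erase_mul _ _ (Finset.mem_univ i)]
  exact hQ i _ _ (hσ i)

/-! ### The split ideal, clearing denominators, and the fibre criterion -/

section SplitIdeal

variable {R : Type*} [CommRing R] {A : Type*} [Ring A] [Algebra R A]
  {M : Type*} [AddCommGroup M] [Module R M] [Module A M] [IsScalarTower R A M]
  {P : Type*} [AddCommGroup P] [Module R P] [Module A P] [IsScalarTower R A P]
  {N : Type*} [AddCommGroup N] [Module R N] [Module A N] [IsScalarTower R A N]

variable (R) in
/-- The ideal of those scalars `σ` for which `σ • id` factors through `h`. -/
def splitIdeal (h : M →ₗ[A] P) : Ideal R where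
  carrier := {σ | ∃ s : P →ₗ[A] M, h ∘ₗ s = σ • LinearMap.id}
  add_mem' := by
    rintro a b ⟨s, hs⟩ ⟨s', hs'⟩
    exact ⟨s + s', by rw [LinearMap.comp_add, hs, hs', add_smul]⟩
  zero_mem' := ⟨0, by simp⟩
  smul_mem' := by
    rintro c a ⟨s, hs⟩
    exact ⟨c • s, by rw [LinearMap.comp_smul, hs, smul_assoc]⟩

lemma splitIdeal_comp_le (h : M →ₗ[A] P) (s : N →ₗ[A] M) :
    splitIdeal R (h ∘ₗ s) ≤ splitIdeal R h := by
  rintro σ ⟨u, hu⟩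
  exact ⟨s ∘ₗ u, by rw [← hu, LinearMap.comp_assoc]⟩

lemma isSplitSurjective_of_forall_isMaximal (h : M →ₗ[A] P)
    (H : ∀ p : Ideal R, p.IsMaximal → ¬ splitIdeal R h ≤ p) : IsSplitSurjective h := by
  have htop : splitIdeal R h = ⊤ := by
    by_contra hne
    obtain ⟨p, hp, hle⟩ := Ideal.exists_le_maximal _ hne
    exact H p hp hle
  obtain ⟨s, hs⟩ := (Ideal.eq_top_iff_one _).1 htop
  exact ⟨s, by rw [hs, one_smul]⟩

/-- A homomorphism with denominators in `T` out of a finitely presented module, given by its graph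
`Γ`, becomes an honest homomorphism after multiplication by an element of `T`. -/
lemma exists_linearMap_of_graph [Module.FinitePresentation A P] (T : Submonoid R)
    (Γ : Submodule A (P × M)) (hdom : ∀ x : P, ∃ σ ∈ T, ∃ m, (σ • x, m) ∈ Γ)
    (hzero : ∀ m, (0, m) ∈ Γ → ∃ σ ∈ T, σ • m = 0) :
    ∃ σ ∈ T, ∃ s : P →ₗ[A] M, ∀ x, (σ • x, s x) ∈ Γ := by
  classical
  have hsmul : ∀ (r : R) (z : P × M), z ∈ Γ → r • z ∈ Γ := fun r z hz => by
    rw [← algebraMap_smul A r z]; exact Γ.smul_mem _ hz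
  obtain ⟨n, k, f, g, hf, hfg⟩ := Module.FinitePresentation.exists_fin' A P
  obtain ⟨σ, hσT, hσ⟩ := exists_common_multiple T
    (fun (i : Fin n) σ => ∃ m, (σ • f (Pi.single i 1), m) ∈ Γ)
    (by
      rintro i σ r ⟨m, hm⟩
      exact ⟨r • m, by rw [mul_smul]; exact hsmul r _ hm⟩)
    (fun i => hdom _)
  choose m hm using hσ
  let ψ : (Fin n → A) →ₗ[A] M := (Pi.basisFun A (Fin n)).constr ℕ m
  have hψ : ∀ x, (σ • f x, ψ x) ∈ Γ := by
    intro x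
    let l : (Fin n → A) →ₗ[A] P × M := (σ • f).prod ψ
    have : (⊤ : Submodule A (Fin n → A)) ≤ Γ.comap l := by
      rw [← (Pi.basisFun A (Fin n)).span_eq, Submodule.span_le]
      rintro _ ⟨i, rfl⟩
      have h1 : ψ ((Pi.basisFun A (Fin n)) i) = m i := Module.Basis.constr_basis _ _ _ _
      change (σ • f _, ψ _) ∈ Γ
      rw [h1]
      simpa using hm i
    exact this (Submodule.mem_top (x := x))
  -- `ψ` sends each of the finitely many relations to an `m` with `(0, m) ∈ Γ`, hence to
  -- `T`-torsion; one `τ` kills all these values, so `τ • ψ` descends to `P`.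
  obtain ⟨τ, hτT, hτ⟩ := exists_common_multiple T
    (fun (i : Fin k) τ => τ • ψ (g (Pi.single i 1)) = 0)
    (by
      intro i σ r h
      rw [mul_smul, h, smul_zero])
    (fun i => hzero _ (by
      have := hψ (g (Pi.single i 1))
      rwa [hfg.apply_apply_eq_zero, smul_zero] at this))
  have hker : LinearMap.ker f ≤ LinearMap.ker (τ • ψ) := by
    have h0 : (τ • ψ) ∘ₗ g = 0 := by
      apply (Pi.basisFun A (Fin k)).ext
      intro i
      simpa using hτ i
    rw [LinearMap.exact_iff.1 hfg]
    exact LinearMap.range_le_ker_iff.2 h0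
  refine ⟨τ * σ, T.mul_mem hτT hσT,
    (LinearMap.ker f).liftQ (τ • ψ) hker ∘ₗ (f.quotKerEquivOfSurjective hf).symm.toLinearMap, ?_⟩
  intro x
  obtain ⟨y, rfl⟩ := hf x
  have h1 : (f.quotKerEquivOfSurjective hf).symm (f y) = Submodule.Quotient.mk y := by
    rw [LinearEquiv.symm_apply_eq]; rfl
  simp only [LinearMap.comp_apply, LinearEquiv.coe_coe, h1]
  rw [mul_smul]
  exact hsmul τ _ (hψ y)

/-- An endomorphism of a finitely presented module splits at `p` as soon as it is surjective
on the fibre at `p`. -/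
lemma splitIdeal_not_le_iff_baseChange [Module.Finite R P] [Module.FinitePresentation A P]
    (p : PrimeSpectrum R) (φ : P →ₗ[A] P) :
    ¬ splitIdeal R φ ≤ p.asIdeal ↔ Function.Surjective
      ((φ.restrictScalars R).baseChange p.asIdeal.ResidueField) := by
  constructor
  · intro h
    obtain ⟨σ, ⟨s, hs⟩, hσ⟩ := SetLike.not_le_iff_exists.1 h
    have h0 : algebraMap R p.asIdeal.ResidueField σ ≠ 0 := by
      rwa [Ne, Ideal.algebraMap_residueField_eq_zero]
    have h1 : (φ.restrictScalars R).baseChange p.asIdeal.ResidueField ∘ₗ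
        (s.restrictScalars R).baseChange p.asIdeal.ResidueField
        = (algebraMap R p.asIdeal.ResidueField σ) • LinearMap.id := by
      rw [← LinearMap.baseChange_comp]
      have : φ.restrictScalars R ∘ₗ s.restrictScalars R = σ • LinearMap.id := by
        ext x; exact LinearMap.congr_fun hs x
      rw [this, LinearMap.baseChange_smul, LinearMap.baseChange_id, algebraMap_smul]
    intro y
    refine ⟨(s.restrictScalars R).baseChange p.asIdeal.ResidueField
      ((algebraMap R p.asIdeal.ResidueField σ)⁻¹ • y), ?_⟩
    have := LinearMap.congr_fun h1 ((algebraMap R p.asIdeal.ResidueField σ)⁻¹ • y)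
    rw [LinearMap.comp_apply] at this
    rw [this, LinearMap.smul_apply, LinearMap.id_apply, smul_smul, mul_inv_cancel₀ h0, one_smul]
  · intro hsurj
    let φR := φ.restrictScalars R
    let C := P ⧸ LinearMap.range φR
    -- Nakayama: the cokernel of `φ` has zero fibre at `p`, so some `σ ∉ p` annihilates it.
    have hC : p ∉ Module.support R C := by
      rw [Module.mem_support_iff_nontrivial_residueField_tensorProduct,
        not_nontrivial_iff_subsingleton]
      let π := (LinearMap.range φR).mkQ
      have hπ : Function.Surjective (π.baseChange p.asIdeal.ResidueField) :=
        LinearMap.lTensor_surjective _ (Submodule.mkQ_surjective _)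
      have h0 : π.baseChange p.asIdeal.ResidueField ∘ₗ φR.baseChange p.asIdeal.ResidueField = 0 := by
        rw [← LinearMap.baseChange_comp, LinearMap.range_mkQ_comp, LinearMap.baseChange_zero]
      refine subsingleton_of_forall_eq 0 fun c => ?_
      obtain ⟨y, rfl⟩ := hπ c
      obtain ⟨x, rfl⟩ := hsurj y
      exact LinearMap.congr_fun h0 x
    rw [Module.mem_support_iff_of_finite, SetLike.not_le_iff_exists] at hC
    obtain ⟨σ, hσC, hσ⟩ := hC
    have hσ' : ∀ x, ∃ y, φ y = σ • x := fun x => by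
      have := Module.mem_annihilator.1 hσC (Submodule.Quotient.mk x)
      rw [← Submodule.Quotient.mk_smul, Submodule.Quotient.mk_eq_zero] at this
      exact this
    -- A surjective endomorphism of a finite module over the commutative ring `R_p` is injective.
    have hinj : ∀ y, φ y = 0 → ∃ τ ∈ p.asIdeal.primeCompl, τ • y = 0 := by
      let Φ := LocalizedModule.map p.asIdeal.primeCompl φR
      have hs : Function.Surjective Φ := by
        intro z
        induction z using LocalizedModule.induction_on with
        | h x b =>
          obtain ⟨y, hy⟩ := hσ' x
          refine ⟨LocalizedModule.mk y (b * ⟨σ, hσ⟩), ?_⟩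
          rw [LocalizedModule.map_mk]
          change LocalizedModule.mk (φ y) _ = _
          rw [hy, LocalizedModule.mk_eq]
          refine ⟨1, ?_⟩
          simp only [Submonoid.smul_def, Submonoid.coe_mul, smul_smul]
      have hi := OrzechProperty.injective_of_surjective_endomorphism Φ hs
      intro y hy
      have h1 : LocalizedModule.mk y (1 : p.asIdeal.primeCompl) = LocalizedModule.mk 0 1 := by
        apply hi
        rw [LocalizedModule.map_mk, LocalizedModule.map_mk]
        change LocalizedModule.mk (φ y) _ = LocalizedModule.mk (φ 0) _
        rw [hy, map_zero]
      obtain ⟨u, hu⟩ := LocalizedModule.mk_eq.1 h1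
      exact ⟨u, u.2, by simpa [Submonoid.smul_def] using hu⟩
    -- The graph of the inverse of `φ`, which exists only with denominators outside `p`.
    let Γ : Submodule A (P × P) :=
      LinearMap.ker (LinearMap.fst A P P - φ ∘ₗ LinearMap.snd A P P)
    have hΓ : ∀ x y, (x, y) ∈ Γ ↔ x = φ y := fun x y => by
      simp [Γ, sub_eq_zero]
    obtain ⟨τ, hτ, s, hs⟩ := exists_linearMap_of_graph p.asIdeal.primeCompl Γ
      (fun x => ⟨σ, hσ, (hσ' x).choose, (hΓ _ _).2 (hσ' x).choose_spec.symm⟩)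
      (fun y hy => hinj y ((hΓ _ _).1 hy).symm)
    have hsτ : φ ∘ₗ s = τ • LinearMap.id := by
      ext x
      exact ((hΓ _ _).1 (hs x)).symm
    exact fun hle => hτ (hle ⟨s, hsτ⟩)

end SplitIdeal

/-! ### Split surjectivity at a prime in terms of the split ideal -/

section Localization

variable {R : Type*} [CommRing R] {S : Type*} [Ring S] [Algebra R S]
  {M : Type*} [AddCommGroup M] [Module R M] [Module Sᵐᵒᵖ M] [IsScalarTower R Sᵐᵒᵖ M]
  {P : Type*} [AddCommGroup P] [Module R P] [Module Sᵐᵒᵖ P] [IsScalarTower R Sᵐᵒᵖ P]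

lemma isSplitSurjectiveAt_of_splitIdeal_not_le {p : PrimeSpectrum R} {h : M →ₗ[Sᵐᵒᵖ] P}
    (H : ¬ splitIdeal R h ≤ p.asIdeal) : IsSplitSurjectiveAt p h := by
  obtain ⟨σ, ⟨s, hs⟩, hσ⟩ := SetLike.not_le_iff_exists.1 H
  let T := p.asIdeal.primeCompl
  let d : T := ⟨σ, hσ⟩
  -- `c = 1/σ` is central, so multiplication by it is linear over the localized ring and corrects
  -- `s` to a true section.
  let c : LocalizedModule T S := LocalizedModule.mk 1 d
  have hc : ∀ x : LocalizedModule T S, c * x = x * c := fun x => by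
    induction x using LocalizedModule.induction_on with
    | h x a => simp only [c, LocalizedModule.mk_mul_mk, one_mul, mul_one, mul_comm]
  let γ : LocalizedModule T P →ₗ[(LocalizedModule T S)ᵐᵒᵖ] LocalizedModule T P :=
    { toFun := fun x => op c • x
      map_add' := smul_add _
      map_smul' := fun x m => by
        induction x using MulOpposite.rec' with | h x =>
        simp only [RingHom.id_apply, smul_smul, ← op_mul, hc] }
  refine ⟨localizedMap T s ∘ₗ γ, ?_⟩
  ext z
  induction z using LocalizedModule.induction_on with
  | h x b =>
    simp only [LinearMap.comp_apply, LinearMap.id_apply, γ, c, LinearMap.coe_mk, AddHom.coe_mk,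
      op_mk_smul_mk]
    rw [localizedMap_mk, localizedMap_mk]
    have : h (s (op (1 : S) • x)) = σ • x := by
      rw [op_one, one_smul]; exact LinearMap.congr_fun hs x
    rw [this, LocalizedModule.mk_eq]
    refine ⟨1, ?_⟩
    simp only [Submonoid.smul_def, Submonoid.coe_mul, smul_smul]
    congr 2
    ring

lemma splitIdeal_not_le_of_isSplitSurjectiveAt [Module.FinitePresentation Sᵐᵒᵖ P]
    [Module.Finite R P] {p : PrimeSpectrum R} {h : M →ₗ[Sᵐᵒᵖ] P}
    (H : IsSplitSurjectiveAt p h) : ¬ splitIdeal R h ≤ p.asIdeal := by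
  obtain ⟨s, hs⟩ := H
  let T := p.asIdeal.primeCompl
  let ι (x : S) : (LocalizedModule T S)ᵐᵒᵖ := op (LocalizedModule.mk x 1)
  -- The part of the graph of the local section `s` visible before localizing: pairs with `s (x/1) =
  -- m/1`.
  let Γ : Submodule Sᵐᵒᵖ (P × M) :=
    { carrier := {z | s (LocalizedModule.mk z.1 1) = LocalizedModule.mk z.2 1}
      add_mem' := by
        intro z w hz hw
        simp only [Set.mem_ofPred_eq, Prod.fst_add, Prod.snd_add] at hz hw ⊢
        have e1 : (LocalizedModule.mk (z.1 + w.1) 1 : LocalizedModule T P)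
              = LocalizedModule.mk z.1 1 + LocalizedModule.mk w.1 1 := by
          simp
        rw [e1, map_add, hz, hw]
        simp
      zero_mem' := by simp
      smul_mem' := by
        intro a z hz
        induction a using MulOpposite.rec' with | h a =>
        simp only [Set.mem_ofPred_eq, Prod.smul_fst, Prod.smul_snd] at hz ⊢
        have e1 : (LocalizedModule.mk (op a • z.1) 1 : LocalizedModule T P)
            = ι a • LocalizedModule.mk z.1 1 := by
          rw [op_mk_smul_mk, mul_one]
        rw [e1, map_smul, hz, op_mk_smul_mk, mul_one] }
  have hdom : ∀ x : P, ∃ σ ∈ T, ∃ m, (σ • x, m) ∈ Γ := by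
    intro x
    obtain ⟨⟨m, d⟩, hm⟩ : ∃ q : M × T, LocalizedModule.mk q.1 q.2 = s (LocalizedModule.mk x 1) := by
      generalize s (LocalizedModule.mk x 1) = y
      induction y using LocalizedModule.induction_on with
      | h m d => exact ⟨(m, d), rfl⟩
    refine ⟨d, d.2, m, ?_⟩
    change s (LocalizedModule.mk _ 1) = LocalizedModule.mk m 1
    have e1 : (LocalizedModule.mk ((d : R) • x) 1 : LocalizedModule T P)
        = ι ((d : R) • 1) • LocalizedModule.mk x 1 := by
      rw [op_mk_smul_mk, mul_one, op_smul_left, op_one, one_smul]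
    rw [e1, map_smul, ← hm, op_mk_smul_mk, op_smul_left, op_one, one_smul, one_mul,
      LocalizedModule.mk_eq]
    refine ⟨1, ?_⟩
    simp only [Submonoid.smul_def, one_smul]
  have hzero : ∀ m, (0, m) ∈ Γ → ∃ σ ∈ T, σ • m = 0 := by
    intro m hm
    change s (LocalizedModule.mk 0 1) = LocalizedModule.mk m 1 at hm
    rw [LocalizedModule.zero_mk, map_zero, ← LocalizedModule.zero_mk 1, LocalizedModule.mk_eq] at hm
    obtain ⟨u, hu⟩ := hm
    exact ⟨u, u.2, by simpa [Submonoid.smul_def, eq_comm] using hu⟩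
  obtain ⟨σ, hσ, u, hu⟩ := exists_linearMap_of_graph T Γ hdom hzero
  have hloc : ∀ x, ∃ τ ∈ T, τ • h (u x) = τ • σ • x := by
    intro x
    have h1 : s (LocalizedModule.mk (σ • x) 1) = LocalizedModule.mk (u x) 1 := hu x
    have h2 := LinearMap.congr_fun hs (LocalizedModule.mk (σ • x) 1)
    rw [LinearMap.comp_apply, h1, localizedMap_mk, LinearMap.id_apply, LocalizedModule.mk_eq] at h2
    obtain ⟨τ, hτ⟩ := h2
    exact ⟨τ, τ.2, by simpa [Submonoid.smul_def] using hτ⟩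
  -- `h ∘ u = σ • id` holds only up to an element of `T` depending on `x`; finitely many
  -- `R`-generators give a uniform one.
  obtain ⟨k, e, he⟩ := Module.Finite.exists_fin (R := R) (M := P)
  obtain ⟨τ, hτT, hτ⟩ := exists_common_multiple T
    (fun (i : Fin k) τ => τ • h (u (e i)) = τ • σ • e i)
    (by
      intro i τ r h
      rw [mul_smul, h, mul_smul])
    (fun i => hloc _)
  refine SetLike.not_le_iff_exists.2 ⟨τ * σ, ⟨τ • u, ?_⟩, T.mul_mem hτT hσ⟩
  have : ((h ∘ₗ (τ • u)).restrictScalars R) = (τ * σ) • LinearMap.id := by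
    refine LinearMap.ext_on_range he fun i => ?_
    simpa [mul_smul] using hτ i
  ext x
  exact LinearMap.congr_fun this x

end Localization

/-! ### Prime avoidance, basic sets and dimension -/

section Primes

variable {R : Type*} [CommRing R]

/-- A tuple can be chosen subject to finitely many conditions, each depending only on the tuple
modulo a prime and achievable along every coset `a + c R^n` with `c` outside that prime. -/
lemma exists_forall_of_finset_primes {n : ℕ} (C : PrimeSpectrum R → (Fin n → R) → Prop)
    (Y : Finset (PrimeSpectrum R))
    (hcongr : ∀ p ∈ Y, ∀ x y : Fin n → R, (∀ i, x i - y i ∈ p.asIdeal) → C p x → C p y)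
    (hC : ∀ p ∈ Y, ∀ (a : Fin n → R) (c : R), c ∉ p.asIdeal → ∃ r : Fin n → R, C p (a + c • r)) :
    ∃ x, ∀ p ∈ Y, C p x := by
  classical
  induction Y using Finset.strongInduction with
  | H Y ih =>
    rcases Y.eq_empty_or_nonempty with rfl | hne
    · exact ⟨0, by simp⟩
    -- With `p` minimal, every other prime of `Y` contains an element outside `p`. Corrections by
    -- multiples of the product of these elements leave the other conditions intact, while `hC`
    -- still applies at `p`.
    obtain ⟨p, hp⟩ := Y.exists_minimal hne
    obtain ⟨a, ha⟩ := ih (Y.erase p) (Finset.erase_ssubset hp.1)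
      (fun q hq => hcongr q (Finset.mem_of_mem_erase hq))
      (fun q hq => hC q (Finset.mem_of_mem_erase hq))
    have hq : ∀ q ∈ Y.erase p, ∃ c ∈ q.asIdeal, c ∉ p.asIdeal := by
      intro q hq
      by_contra! hcon
      have hle : q ≤ p := hcon
      exact Finset.ne_of_mem_erase hq (le_antisymm hle (hp.2 (Finset.mem_of_mem_erase hq) hle))
    choose! c hcq hcp using hq
    obtain ⟨r, hr⟩ := hC p hp.1 a (∏ q ∈ Y.erase p, c q)
      (fun h => by
        obtain ⟨q, hq, h'⟩ := p.2.prod_mem_iff.1 h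
        exact hcp q hq h')
    refine ⟨a + (∏ q ∈ Y.erase p, c q) • r, fun q hqY => ?_⟩
    rcases eq_or_ne q p with rfl | hne
    · exact hr
    have hqe := Finset.mem_erase.2 ⟨hne, hqY⟩
    refine hcongr q hqY a _ (fun i => ?_) (ha q hqe)
    have : a i - (a + (∏ q ∈ Y.erase p, c q) • r) i = -(r i) * ∏ q ∈ Y.erase p, c q := by
      simp; ring
    rw [this]
    exact q.asIdeal.mul_mem_left _ (q.asIdeal.prod_mem hqe (hcq q hqe))

/-- A homogeneous linear system over `R` with more unknowns than equations has a solution modulo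
`p` that is nonzero modulo `p`. -/
lemma exists_mulVec_mem_prime {m n : ℕ} (hmn : m < n) (B : Matrix (Fin m) (Fin n) R)
    (p : PrimeSpectrum R) :
    ∃ v : Fin n → R, (∃ j, v j ∉ p.asIdeal) ∧ ∀ l, ∑ j, B l j * v j ∈ p.asIdeal := by
  let D := R ⧸ p.asIdeal
  let B' : Matrix (Fin m) (Fin n) D := B.map (Ideal.Quotient.mk _)
  have hinj : ¬ Function.Injective (Matrix.mulVecLin B') := fun h =>
    absurd (le_of_fin_injective D _ h) (by omega)
  rw [← LinearMap.ker_eq_bot, Submodule.eq_bot_iff] at hinj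
  push Not at hinj
  obtain ⟨w, hw, hw0⟩ := hinj
  choose v hv using fun j => Ideal.Quotient.mk_surjective (w j)
  obtain ⟨j, hj⟩ := Function.ne_iff.1 hw0
  refine ⟨v, ⟨j, fun h => hj ?_⟩, fun l => ?_⟩
  · rw [← hv, Ideal.Quotient.eq_zero_iff_mem.2 h]; rfl
  · have := congrFun (LinearMap.mem_ker.1 hw) l
    rw [← Ideal.Quotient.eq_zero_iff_mem, map_sum]
    simpa [Matrix.mulVec, dotProduct, B', hv] using this

/-- `Z ∩ X` has finitely many irreducible components since `X` is Noetherian. The vanishing ideal of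
a component is a prime that is an intersection of members of `X`, so each component has a generic
point in `X`, and a minimal point must be one of these. -/
lemma IsBasicSet.finite_minimal {X : Set (PrimeSpectrum R)} (hX : IsBasicSet X)
    {Z : Set (PrimeSpectrum R)} (hZ : IsClosed Z) :
    {p | p ∈ X ∧ p ∈ Z ∧ ∀ q ∈ X, q ∈ Z → q ≤ p → q = p}.Finite := by
  have := hX.noetherian
  obtain ⟨S, hS, hcl, hirr, hU⟩ := NoetherianSpace.exists_finite_set_isClosed_irreducible
    (hZ.preimage (continuous_subtype_val (p := fun p => p ∈ X)))
  have key : ∀ C ∈ S, ∃ q : X, q ∈ C ∧ ∀ p ∈ C, q.1 ≤ p.1 := by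
    intro C hC
    let C' : Set (PrimeSpectrum R) := Subtype.val '' C
    have hI : (PrimeSpectrum.vanishingIdeal C').IsPrime :=
      PrimeSpectrum.isIrreducible_iff_vanishingIdeal_isPrime.1
        ((hirr C hC).image _ continuous_subtype_val.continuousOn)
    let q : PrimeSpectrum R := ⟨_, hI⟩
    have hqX : q ∈ X := by
      refine hX.mem_of_eq_sInf q C' (by rintro _ ⟨x, -, rfl⟩; exact x.2) ?_
      rw [sInf_image]
      rfl
    refine ⟨⟨q, hqX⟩, ?_, fun p hp => ?_⟩
    · obtain ⟨V, hV, hVC⟩ := isClosed_induced_iff.1 (hcl C hC)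
      rw [← hVC]
      have : closure C' ⊆ V := closure_minimal (by
        rintro _ ⟨x, hx, rfl⟩
        rw [← hVC] at hx
        exact hx) hV
      apply this
      rw [← PrimeSpectrum.zeroLocus_vanishingIdeal_eq_closure]
      exact le_refl q.asIdeal
    · intro f hf
      exact (PrimeSpectrum.mem_vanishingIdeal _ _).1 hf p.1 ⟨p, hp, rfl⟩
  choose q hqC hq using key
  have := hS.to_subtype
  refine (Set.finite_range fun C : S => (q C.1 C.2).1).subset ?_
  rintro p ⟨hpX, hpZ, hmin⟩
  have hp : (⟨p, hpX⟩ : X) ∈ ⋃₀ S := by rw [← hU]; exact hpZ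
  obtain ⟨C, hC, hpC⟩ := hp
  have hqZ : q C hC ∈ ⋃₀ S := ⟨C, hC, hqC C hC⟩
  rw [← hU] at hqZ
  exact ⟨⟨C, hC⟩, hmin _ (q C hC).2 hqZ (hq C hC _ hpC)⟩

/-- `V(q) ∩ X` is irreducible with generic point `q`, which lies outside `V(p)`. So the whole space
can be put on top of every chain of irreducible closed sets coming from `V(p) ∩ X`. -/
lemma dimAt_add_one_le {X : Set (PrimeSpectrum R)} {q p : PrimeSpectrum R} (hq : q ∈ X)
    (hqp : q < p) : dimAt X p + 1 ≤ dimAt X q := by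
  have hsub : PrimeSpectrum.zeroLocus (p.asIdeal : Set R) ∩ X
      ⊆ PrimeSpectrum.zeroLocus (q.asIdeal : Set R) ∩ X := fun x hx =>
    ⟨fun r hr => hx.1 (hqp.le hr), hx.2⟩
  let f := Set.inclusion hsub
  have hf : Topology.IsInducing f := (Topology.IsEmbedding.inclusion hsub).isInducing
  let x : ↥(PrimeSpectrum.zeroLocus (q.asIdeal : Set R) ∩ X) := ⟨q, fun r hr => hr, hq⟩
  have hspec : ∀ y, y ∈ closure {x} := by
    intro y
    rw [Topology.IsInducing.subtypeVal.closure_eq_preimage_closure_image]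
    simp only [Set.image_singleton, Set.mem_preimage]
    rw [PrimeSpectrum.closure_singleton]
    exact y.2.1
  let top : IrreducibleCloseds ↥(PrimeSpectrum.zeroLocus (q.asIdeal : Set R) ∩ X) :=
    ⟨Set.univ, by
      rw [← Set.eq_univ_of_forall hspec]
      exact isIrreducible_singleton.closure, isClosed_univ⟩
  let Φ : WithTop (IrreducibleCloseds ↥(PrimeSpectrum.zeroLocus (p.asIdeal : Set R) ∩ X)) →
      IrreducibleCloseds ↥(PrimeSpectrum.zeroLocus (q.asIdeal : Set R) ∩ X) :=
    fun a => a.recTopCoe top (fun c => IrreducibleCloseds.map f hf.continuous c)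
  have hcl : IsClosed {y : ↥(PrimeSpectrum.zeroLocus (q.asIdeal : Set R) ∩ X) |
      (y : PrimeSpectrum R) ∈ PrimeSpectrum.zeroLocus (p.asIdeal : Set R)} :=
    (PrimeSpectrum.isClosed_zeroLocus _).preimage continuous_subtype_val
  have hΦ : StrictMono Φ := by
    intro a b hab
    induction a using WithTop.recTopCoe with
    | top => exact absurd hab not_top_lt
    | coe a =>
      induction b using WithTop.recTopCoe with
      | top =>
        have hle : (IrreducibleCloseds.map f hf.continuous a).carrier ⊆
            {y : ↥(PrimeSpectrum.zeroLocus (q.asIdeal : Set R) ∩ X) |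
              (y : PrimeSpectrum R) ∈ PrimeSpectrum.zeroLocus (p.asIdeal : Set R)} := by
          refine closure_minimal ?_ hcl
          rintro _ ⟨y, -, rfl⟩
          exact y.2.1
        refine lt_of_le_of_ne (fun y _ => Set.mem_univ y) fun heq => ?_
        have hx : x ∈ (IrreducibleCloseds.map f hf.continuous a).carrier := by
          have : Φ (a : WithTop _) = Φ ⊤ := heq
          change x ∈ (Φ (a : WithTop _)).carrier
          rw [this]
          exact Set.mem_univ x
        exact absurd (hle hx) hqp.not_ge
      | coe b =>
        exact IrreducibleCloseds.map_strictMono_of_isInducing hf (WithTop.coe_lt_coe.1 hab)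
  have := Order.krullDim_le_of_strictMono Φ hΦ
  rcases (isEmpty_or_nonempty (IrreducibleCloseds
    ↥(PrimeSpectrum.zeroLocus (p.asIdeal : Set R) ∩ X))).symm with hne | hne
  · rwa [Order.krullDim_WithTop] at this
  -- If `V(p) ∩ X` is empty, the left side is `⊥ + 1 = ⊥`.
  · unfold dimAt topologicalKrullDim
    rw [Order.krullDim_eq_bot]
    simp

lemma exists_nat_dimAt {X : Set (PrimeSpectrum R)} (hdim : topologicalKrullDim X < ⊤)
    {p : PrimeSpectrum R} (hp : p ∈ X) : ∃ d : ℕ, dimAt X p = d := by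
  have h1 : dimAt X p ≤ topologicalKrullDim X :=
    (Topology.IsEmbedding.inclusion Set.inter_subset_right).isInducing.topologicalKrullDim_le
  let x : ↥(PrimeSpectrum.zeroLocus (p.asIdeal : Set R) ∩ X) := ⟨p, fun r hr => hr, hp⟩
  have : Nonempty (IrreducibleCloseds ↥(PrimeSpectrum.zeroLocus (p.asIdeal : Set R) ∩ X)) :=
    ⟨⟨closure {x}, isIrreducible_singleton.closure, isClosed_closure⟩⟩
  have h2 : 0 ≤ dimAt X p := Order.krullDim_nonneg
  have h3 := h1.trans_lt hdim
  generalize dimAt X p = D at h2 h3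
  induction D using WithBot.recBotCoe with
  | bot => simp at h2
  | coe D =>
    have hD : D ≠ ⊤ := by
      rintro rfl
      exact lt_irrefl _ h3
    lift D to ℕ using hD
    exact ⟨D, rfl⟩

end Primes

/-! ### Perturbing endomorphisms modulo a prime -/

section Fibre

variable {R : Type*} [CommRing R] {A : Type*} [Ring A] [Algebra R A]
  {M : Type*} [AddCommGroup M] [Module R M] [Module A M] [IsScalarTower R A M]
  {P : Type*} [AddCommGroup P] [Module R P] [Module A P] [IsScalarTower R A P]
  [Module.Finite R P] [Module.FinitePresentation A P]
  {N : Type*} [AddCommGroup N] [Module R N] [Module A N] [IsScalarTower R A N]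
  [Module.Finite R N] [Module.FinitePresentation A N]

lemma splitIdeal_not_le_congr {p : PrimeSpectrum R} {φ φ' : P →ₗ[A] P}
    (h : ∀ x, φ x - φ' x ∈ p.asIdeal • (⊤ : Submodule R P))
    (hφ : ¬ splitIdeal R φ ≤ p.asIdeal) : ¬ splitIdeal R φ' ≤ p.asIdeal := by
  rw [splitIdeal_not_le_iff_baseChange] at hφ ⊢
  convert! hφ using 2
  refine TensorProduct.AlgebraTensorModule.ext fun a x => ?_
  rw [LinearMap.baseChange_tmul, LinearMap.baseChange_tmul, ← sub_eq_zero, ← neg_eq_zero, neg_sub,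
    ← TensorProduct.tmul_sub]
  refine Submodule.smul_induction_on (p := fun y => a ⊗ₜ[R] y = 0) (h x) ?_ ?_
  · intro r hr n _
    rw [← TensorProduct.smul_tmul, Algebra.smul_def, Ideal.algebraMap_residueField_eq_zero.2 hr,
      zero_mul, TensorProduct.zero_tmul]
  · intro y z hy hz
    rw [TensorProduct.tmul_add, hy, hz, add_zero]

omit [Module R M] [IsScalarTower R A M] in
lemma splitIdeal_pi_comp_not_le_congr {p : PrimeSpectrum R} {m : ℕ} (s : (Fin m → N) →ₗ[A] M)
    (h h' : Fin m → (M →ₗ[A] N)) (g : M →ₗ[A] N) (c : Fin m → R) (hc : ∀ l, c l ∈ p.asIdeal)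
    (hh : ∀ l, h l = h' l + c l • g)
    (H : ¬ splitIdeal R (LinearMap.pi h ∘ₗ s) ≤ p.asIdeal) :
    ¬ splitIdeal R (LinearMap.pi h' ∘ₗ s) ≤ p.asIdeal := by
  classical
  refine splitIdeal_not_le_congr (fun x => ?_) H
  have : (LinearMap.pi h ∘ₗ s) x - (LinearMap.pi h' ∘ₗ s) x
      = ∑ l, c l • (Pi.single l (g (s x)) : Fin m → N) := by
    ext l
    simp [hh, Finset.sum_apply, Pi.single_apply]
  rw [this]
  exact Submodule.sum_mem _ fun l _ => Submodule.smul_mem_smul (hc l) trivial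

/-- If `R/p` is finite it is a field, and `y` can be taken inverse to `d`, which removes `θ` modulo
`p`. If `R/p` is infinite, each failing `y` yields its own eigenvalue of `θ` on the
finite-dimensional fibre, so not all `y` can fail. -/
lemma exists_splitIdeal_pencil_not_le (p : PrimeSpectrum R) {d e : R} (hd : d ∉ p.asIdeal)
    (he : e ∉ p.asIdeal) (θ : P →ₗ[A] P) :
    ∃ y : R, ¬ splitIdeal R (e • LinearMap.id + (d * y - 1) • θ) ≤ p.asIdeal := by
  rcases finite_or_infinite (R ⧸ p.asIdeal) with hfin | hinf
  · have hmax : p.asIdeal.IsMaximal :=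
      Ideal.Quotient.maximal_of_isField _ (Finite.isField_of_domain _)
    obtain ⟨y, hy⟩ := hmax.exists_inv hd
    obtain ⟨i, hi, hyi⟩ := hy
    refine ⟨y, splitIdeal_not_le_congr (φ := e • LinearMap.id) (fun x => ?_)
      (fun hle => he (hle ⟨LinearMap.id, by simp⟩))⟩
    have h1 : (e • LinearMap.id : P →ₗ[A] P) x - (e • LinearMap.id + (d * y - 1) • θ : P →ₗ[A] P) x
        = i • θ x := by
      rw [← hyi]
      simp only [LinearMap.add_apply, LinearMap.smul_apply]
      rw [sub_add_cancel_left, ← neg_smul]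
      congr 1
      ring
    rw [h1]
    exact Submodule.smul_mem_smul hi trivial
  · by_contra! hcon
    let K := p.asIdeal.ResidueField
    let Θ : Module.End K (K ⊗[R] P) := (θ.restrictScalars R).baseChange K
    -- The eigenvalue forced by failure at `q`. With `0⁻¹ = 0` the formula stays injective even
    -- where `d * q = 1`, and failure is impossible there because the pencil reduces to `e • id`.
    let f : R ⧸ p.asIdeal → K := fun q => - algebraMap R K e *
      (algebraMap R K d * algebraMap (R ⧸ p.asIdeal) K q - 1)⁻¹
    have hd' : algebraMap R K d ≠ 0 := by rwa [Ne, Ideal.algebraMap_residueField_eq_zero]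
    have he' : algebraMap R K e ≠ 0 := by rwa [Ne, Ideal.algebraMap_residueField_eq_zero]
    have hf : Function.Injective f := by
      intro q q' hqq
      have h1 := inv_injective (mul_left_cancel₀ (neg_ne_zero.2 he') hqq)
      have h2 := mul_left_cancel₀ hd' (sub_left_injective h1)
      exact p.asIdeal.injective_algebraMap_quotient_residueField h2
    refine Set.infinite_of_injective_forall_mem hf (s := {μ | Θ.HasEigenvalue μ}) ?_
      (Module.End.finite_hasEigenvalue Θ)
    intro q
    obtain ⟨y, rfl⟩ := Ideal.Quotient.mk_surjective q
    have hy : ¬ ¬ splitIdeal R (e • LinearMap.id + (d * y - 1) • θ) ≤ p.asIdeal :=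
      not_not.2 (hcon y)
    rw [splitIdeal_not_le_iff_baseChange] at hy
    have hbc : ((e • LinearMap.id + (d * y - 1) • θ : P →ₗ[A] P).restrictScalars R).baseChange K
        = algebraMap R K e • LinearMap.id + (algebraMap R K (d * y - 1)) • Θ := by
      have : (e • LinearMap.id + (d * y - 1) • θ : P →ₗ[A] P).restrictScalars R
        = e • LinearMap.id + (d * y - 1) • θ.restrictScalars R := rfl
      rw [this, LinearMap.baseChange_add, LinearMap.baseChange_smul, LinearMap.baseChange_smul,
        LinearMap.baseChange_id, algebraMap_smul, algebraMap_smul]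
    rw [hbc, ← LinearMap.injective_iff_surjective, ← LinearMap.ker_eq_bot,
      Submodule.eq_bot_iff] at hy
    push Not at hy
    obtain ⟨x, hx, hx0⟩ := hy
    rw [LinearMap.mem_ker, LinearMap.add_apply, LinearMap.smul_apply, LinearMap.smul_apply,
      LinearMap.id_apply] at hx
    have hyq : algebraMap R K (d * y - 1)
        = algebraMap R K d * algebraMap (R ⧸ p.asIdeal) K (Ideal.Quotient.mk _ y) - 1 := by
      rw [map_sub, map_mul, map_one]; rfl
    have hne : algebraMap R K (d * y - 1) ≠ 0 := by
      intro h0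
      rw [h0, zero_smul, add_zero] at hx
      exact (smul_ne_zero he' hx0) hx
    refine Module.End.hasEigenvalue_of_hasEigenvector (x := x) ⟨?_, hx0⟩
    rw [Module.End.mem_eigenspace_iff]
    simp only [f]
    rw [← hyq]
    have h3 : Θ x = (algebraMap R K (d * y - 1))⁻¹ • (algebraMap R K (d * y - 1) • Θ x) := by
      rw [smul_smul, inv_mul_cancel₀ hne, one_smul]
    rw [h3, eq_neg_of_add_eq_zero_right hx, smul_neg, smul_smul, neg_mul, neg_smul, mul_comm]

end Fibre

/-! ### Split tuples and the reduction of the number of generators -/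

section Tuples

variable {R : Type*} [CommRing R] {A : Type*} [Ring A] [Algebra R A]
  {M : Type*} [AddCommGroup M] [Module R M] [Module A M] [IsScalarTower R A M]
  {N : Type*} [AddCommGroup N] [Module R N] [Module A N] [IsScalarTower R A N]

/-- Some `j`-tuple in `F`, viewed as a map `M → N^j`, splits at `p`. -/
def HasSplitTuple (p : PrimeSpectrum R) (F : Submodule R (M →ₗ[A] N)) (j : ℕ) : Prop :=
  ∃ h : Fin j → (M →ₗ[A] N), (∀ i, h i ∈ F) ∧ ¬ splitIdeal R (LinearMap.pi h) ≤ p.asIdeal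

lemma isClosed_setOf_not_hasSplitTuple (F : Submodule R (M →ₗ[A] N)) (j : ℕ) :
    IsClosed {p : PrimeSpectrum R | ¬ HasSplitTuple p F j} := by
  have : {p : PrimeSpectrum R | ¬ HasSplitTuple p F j}
      = ⋂ h ∈ {h : Fin j → (M →ₗ[A] N) | ∀ i, h i ∈ F},
        PrimeSpectrum.zeroLocus (splitIdeal R (LinearMap.pi h) : Set R) := by
    ext p
    simp [HasSplitTuple, PrimeSpectrum.mem_zeroLocus]
  rw [this]
  exact isClosed_biInter fun h _ => PrimeSpectrum.isClosed_zeroLocus _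

/-- Extension by zero of tuples along a map of index sets. -/
def extendTuple {j k : ℕ} (e : Fin j → Fin k) : (Fin j → N) →ₗ[A] (Fin k → N) :=
  ∑ i, LinearMap.single A (fun _ => N) (e i) ∘ₗ LinearMap.proj i

lemma extendTuple_apply {j k : ℕ} (e : Fin j → Fin k) (x : Fin j → N) (l : Fin k) :
    extendTuple (A := A) e x l = ∑ i, if e i = l then x i else 0 := by
  simp [extendTuple, LinearMap.sum_apply, Finset.sum_apply, Pi.single_apply, eq_comm]

lemma extendTuple_apply_self {j k : ℕ} {e : Fin j → Fin k} (he : Function.Injective e)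
    (x : Fin j → N) (i : Fin j) : extendTuple (A := A) e x (e i) = x i := by
  simp [extendTuple_apply, he.eq_iff]

lemma HasSplitTuple.mono {p : PrimeSpectrum R} {F F' : Submodule R (M →ₗ[A] N)} {j k : ℕ}
    (hF : F ≤ F') (hjk : j ≤ k) (H : HasSplitTuple p F k) : HasSplitTuple p F' j := by
  obtain ⟨h, hh, hsplit⟩ := H
  obtain ⟨σ, ⟨s, hs⟩, hσ⟩ := SetLike.not_le_iff_exists.1 hsplit
  refine ⟨fun i => h (Fin.castLE hjk i), fun i => hF (hh _), fun hle => hσ (hle ?_)⟩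
  refine ⟨s ∘ₗ extendTuple (Fin.castLE hjk), LinearMap.ext fun x => funext fun i => ?_⟩
  have := congrFun (LinearMap.congr_fun hs (extendTuple (A := A) (Fin.castLE hjk) x))
    (Fin.castLE hjk i)
  simpa [extendTuple_apply_self (Fin.castLE_injective hjk)] using this

variable [Module.Finite R N] [Module.FinitePresentation A N]

/-- Write `h l = h' l + c l • g`. If all `c l` lie in `p`, then `h'` agrees with `h` on the fibre
and nothing is lost. Otherwise a coefficient `c i ∉ p` serves as a pivot to eliminate `g` from the
other entries, at the price of the entry `i`. -/
lemma HasSplitTuple.of_le_sup_span_singleton {p : PrimeSpectrum R}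
    {F F' : Submodule R (M →ₗ[A] N)} {g : M →ₗ[A] N} (hF : F ≤ F' ⊔ R ∙ g) {j : ℕ}
    (H : HasSplitTuple p F (j + 1)) : HasSplitTuple p F' j := by
  obtain ⟨h, hh, hsplit⟩ := H
  obtain ⟨σ, ⟨s, hs⟩, hσ⟩ := SetLike.not_le_iff_exists.1 hsplit
  have hdec : ∀ l, ∃ h' ∈ F', ∃ c : R, h l = h' + c • g := fun l => by
    obtain ⟨h', hh', z, hz, hsum⟩ := Submodule.mem_sup.1 (hF (hh l))
    obtain ⟨c, rfl⟩ := Submodule.mem_span_singleton.1 hz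
    exact ⟨h', hh', c, hsum.symm⟩
  choose h' hh' c hc using hdec
  by_cases hcp : ∀ l, c l ∈ p.asIdeal
  · have h1 : ¬ splitIdeal R (LinearMap.pi h ∘ₗ s) ≤ p.asIdeal := fun hle =>
      hσ (hle ⟨LinearMap.id, by rw [hs, LinearMap.comp_id]⟩)
    have h2 := splitIdeal_pi_comp_not_le_congr s h h' g c hcp hc h1
    exact HasSplitTuple.mono le_rfl j.le_succ
      ⟨h', hh', fun hle => h2 ((splitIdeal_comp_le _ _).trans hle)⟩
  · push Not at hcp
    obtain ⟨i, hi⟩ := hcp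
    refine ⟨fun l => c i • h (i.succAbove l) - c (i.succAbove l) • h i, fun l => ?_,
      fun hle => p.2.mul_notMem hi hσ (hle ?_)⟩
    · have : c i • h (i.succAbove l) - c (i.succAbove l) • h i
          = c i • h' (i.succAbove l) - c (i.succAbove l) • h' i := by
        rw [hc, hc i, smul_add, smul_add, smul_smul, smul_smul, mul_comm (c i)]
        abel
      change c i • h (i.succAbove l) - c (i.succAbove l) • h i ∈ F'
      rw [this]
      exact F'.sub_mem (F'.smul_mem _ (hh' _)) (F'.smul_mem _ (hh' _))
    -- On tuples with zero `i`-th coordinate, `h i ∘ s` vanishes, so the subtracted pivot terms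
    -- disappear and the scalar is `c i * σ`.
    · refine ⟨s ∘ₗ extendTuple i.succAbove, LinearMap.ext fun x => funext fun l => ?_⟩
      have h1 := fun k => congrFun (LinearMap.congr_fun hs (extendTuple (A := A) i.succAbove x)) k
      have h2 : h (i.succAbove l) (s (extendTuple (A := A) i.succAbove x)) = σ • x l := by
        simpa [extendTuple_apply_self Fin.succAbove_right_injective] using h1 (i.succAbove l)
      have h3 : h i (s (extendTuple (A := A) i.succAbove x)) = 0 := by
        simpa [extendTuple_apply] using h1 i
      simp [h2, h3, mul_smul]

omit [Module R M] [IsScalarTower R A M] [Module.Finite R N] [Module.FinitePresentation A N] in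
lemma exists_sum_smul_of_forall_mem_span {n m : ℕ} {f : Fin n → (M →ₗ[A] N)}
    {h : Fin m → (M →ₗ[A] N)} (hh : ∀ l, h l ∈ Submodule.span R (Set.range f)) :
    ∃ B : Matrix (Fin m) (Fin n) R, ∀ l, h l = ∑ j, B l j • f j := by
  choose B hB using fun l => (Submodule.mem_span_range_iff_exists_fun R).1 (hh l)
  exact ⟨B, fun l => (hB l).symm⟩

/-- The end of the reduction. A split tuple in the span is `β ∘ f` for a square matrix `β`. On the
finite-dimensional fibre, surjectivity of `β ∘ f ∘ s` gives injectivity, hence `f ∘ s` is injective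
and so surjective. -/
lemma splitIdeal_pi_not_le_of_hasSplitTuple {p : PrimeSpectrum R} {t : ℕ}
    {f : Fin t → (M →ₗ[A] N)} (H : HasSplitTuple p (Submodule.span R (Set.range f)) t) :
    ¬ splitIdeal R (LinearMap.pi f) ≤ p.asIdeal := by
  obtain ⟨h, hh, hsplit⟩ := H
  obtain ⟨σ, ⟨s, hs⟩, hσ⟩ := SetLike.not_le_iff_exists.1 hsplit
  obtain ⟨B, hB⟩ := exists_sum_smul_of_forall_mem_span hh
  let β : (Fin t → N) →ₗ[A] (Fin t → N) := LinearMap.pi fun l => ∑ j, B l j • LinearMap.proj j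
  have hβ : LinearMap.pi h = β ∘ₗ LinearMap.pi f := by
    refine LinearMap.ext fun x => funext fun l => ?_
    simp [β, hB, LinearMap.sum_apply]
  let φ : (Fin t → N) →ₗ[A] (Fin t → N) := LinearMap.pi f ∘ₗ s
  have hβφ : β ∘ₗ φ = σ • LinearMap.id := by rw [← hs, hβ, LinearMap.comp_assoc]
  have h1 : ¬ splitIdeal R (β ∘ₗ φ) ≤ p.asIdeal := fun hle =>
    hσ (hle ⟨LinearMap.id, by rw [hβφ, LinearMap.comp_id]⟩)
  have h2 : ¬ splitIdeal R φ ≤ p.asIdeal := by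
    rw [splitIdeal_not_le_iff_baseChange] at h1 ⊢
    have hcomp : (β ∘ₗ φ).restrictScalars R = β.restrictScalars R ∘ₗ φ.restrictScalars R := rfl
    rw [hcomp, LinearMap.baseChange_comp, ← LinearMap.injective_iff_surjective] at h1
    rw [← LinearMap.injective_iff_surjective]
    rw [LinearMap.coe_comp] at h1
    exact h1.of_comp
  exact fun hle => h2 ((splitIdeal_comp_le _ _).trans hle)

/-- If `h = Q f + q g` splits at `p` and `(Q | q)` has a kernel vector modulo `p` whose last
coordinate is nonzero, then `Q (f + a g)` splits at `p` for some `a` in each coset of `c R^n`. -/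
lemma exists_smul_add_splitIdeal_not_le {p : PrimeSpectrum R} {m n : ℕ} (f : Fin n → (M →ₗ[A] N))
    (g : M →ₗ[A] N) (Q : Matrix (Fin m) (Fin n) R) (q : Fin m → R)
    (s : (Fin m → N) →ₗ[A] M) {σ : R} (hσ : σ ∉ p.asIdeal)
    (hs : LinearMap.pi (fun l => ∑ i, Q l i • f i + q l • g) ∘ₗ s = σ • LinearMap.id)
    (v : Fin n → R) {u : R} (hu : u ∉ p.asIdeal)
    (hv : ∀ l, ∑ i, Q l i * v i + q l * u ∈ p.asIdeal)
    (a : Fin n → R) {c : R} (hc : c ∉ p.asIdeal) :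
    ∃ r : Fin n → R, ¬ splitIdeal R
      (LinearMap.pi (fun l => ∑ i, Q l i • (f i + (a + c • r) i • g)) ∘ₗ s) ≤ p.asIdeal := by
  let z : Fin m → R := fun l => -(∑ i, Q l i * v i + u * ∑ i, Q l i * a i)
  let θ : (Fin m → N) →ₗ[A] (Fin m → N) := LinearMap.pi (fun l => z l • g) ∘ₗ s
  obtain ⟨y, hy⟩ := exists_splitIdeal_pencil_not_le p (p.2.mul_notMem hc hu)
    (p.2.mul_notMem hu hσ) θ
  -- `a + c • r` runs along the line from `a` to `-v/u`, reached when `c * u * y = 1`. At that point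
  -- `Q (f + a g)` agrees modulo `p` with `Q f + q g`, because `Q v + q u ∈ p`. In general, after
  -- multiplication by `u`, the deviation is `(c * u * y - 1) • z • g`: this is the pencil in `θ`.
  refine ⟨fun i => y * (-v i - u * a i), ?_⟩
  let k : Fin m → (M →ₗ[A] N) := fun l =>
    ∑ i, Q l i • (f i + (a + c • fun i => y * (-v i - u * a i)) i • g)
  let h : Fin m → (M →ₗ[A] N) := fun l =>
    u • (∑ i, Q l i • f i + q l • g) + (c * u * y - 1) • z l • g
  have hpen : (u * σ) • LinearMap.id + (c * u * y - 1) • θ = LinearMap.pi h ∘ₗ s := by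
    refine LinearMap.ext fun x => funext fun l => ?_
    have := congrFun (LinearMap.congr_fun hs x) l
    simp only [LinearMap.comp_apply, LinearMap.pi_apply, LinearMap.smul_apply, LinearMap.id_apply,
      Pi.smul_apply] at this
    simp only [h, θ, LinearMap.comp_apply, LinearMap.pi_apply, LinearMap.smul_apply,
      LinearMap.id_apply, Pi.smul_apply, LinearMap.add_apply, Pi.add_apply, mul_smul] at this ⊢
    rw [this]
  rw [hpen] at hy
  have h1 := splitIdeal_pi_comp_not_le_congr s h (fun l => u • k l) g
    (fun l => ∑ i, Q l i * v i + q l * u) hv (fun l => by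
      have hk : k l = ∑ i, Q l i • f i
          + (∑ i, Q l i * a i + c * y * (-(∑ i, Q l i * v i) - u * ∑ i, Q l i * a i)) • g := by
        simp only [k, smul_add, Finset.sum_add_distrib, smul_smul, ← Finset.sum_smul]
        congr 2
        rw [Finset.mul_sum, ← Finset.sum_neg_distrib, ← Finset.sum_sub_distrib, Finset.mul_sum,
          ← Finset.sum_add_distrib]
        refine Finset.sum_congr rfl fun i _ => ?_
        simp only [Pi.add_apply, Pi.smul_apply, smul_eq_mul]
        ring
      rw [hk]
      simp only [h, z]
      module) hy
  have h2 : LinearMap.pi (fun l => u • k l) ∘ₗ s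
      = (LinearMap.pi k ∘ₗ s) ∘ₗ (u • LinearMap.id) := by
    refine LinearMap.ext fun x => funext fun l => ?_
    simp
  rw [h2] at h1
  exact fun hle => h1 ((splitIdeal_comp_le _ _).trans hle)

/-- The inductive step: `n + 1` generators of which sufficiently many split at each prime of `X`
can be replaced by `n` elements of their span with the same property. -/
lemma exists_tuple_succ {X : Set (PrimeSpectrum R)} (hX : IsBasicSet X)
    (hdim : topologicalKrullDim X < ⊤) {t n : ℕ} (f : Fin (n + 1) → (M →ₗ[A] N))
    (H : ∀ p ∈ X, ∀ d : ℕ, dimAt X p = d →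
      HasSplitTuple p (Submodule.span R (Set.range f)) (min (n + 1) (t + d))) :
    ∃ f' : Fin n → (M →ₗ[A] N), (∀ i, f' i ∈ Submodule.span R (Set.range f)) ∧
      ∀ p ∈ X, ∀ d : ℕ, dimAt X p = d →
        HasSplitTuple p (Submodule.span R (Set.range f')) (min n (t + d)) := by
  classical
  let F := Submodule.span R (Set.range f)
  let Z : ℕ → Set (PrimeSpectrum R) := fun j => {p | ¬ HasSplitTuple p F (j + 1)}
  -- The primes with neither a spare split element nor a target capped at `n`; elsewhere dropping
  -- `g` is harmless.
  let bad : Set (PrimeSpectrum R) :=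
    {p | p ∈ X ∧ ∃ d : ℕ, dimAt X p = d ∧ t + d ≤ n ∧ ¬ HasSplitTuple p F (t + d + 1)}
  have hbad : bad.Finite := by
    -- A bad `p` is minimal in `X` among primes without a split `(t + d + 1)`-tuple: a smaller `q ∈
    -- X` has `dim_X q ≥ d + 1`, and `t + d + 1 ≤ n + 1`.
    refine (Set.finite_iUnion fun j : Fin (n + 1) => hX.finite_minimal
      (isClosed_setOf_not_hasSplitTuple F (j + 1))).subset ?_
    rintro p ⟨hpX, d, hd, hdn, hp⟩
    refine Set.mem_iUnion.2 ⟨⟨t + d, by omega⟩, hpX, hp, fun q hqX hq hqp => ?_⟩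
    by_contra hne
    have h1 := dimAt_add_one_le hqX (lt_of_le_of_ne hqp hne)
    obtain ⟨d', hd'⟩ := exists_nat_dimAt hdim hqX
    rw [hd, hd'] at h1
    have h2 : d + 1 ≤ d' := by exact_mod_cast h1
    exact hq ((H q hqX d' hd').mono le_rfl (by simp only [le_min_iff]; omega))
  have hdata : ∀ p ∈ hbad.toFinset, ∃ d : ℕ, dimAt X p = d ∧
      ∃ (B : Matrix (Fin (t + d)) (Fin (n + 1)) R) (s : (Fin (t + d) → N) →ₗ[A] M) (σ : R)
        (v : Fin (n + 1) → R), σ ∉ p.asIdeal ∧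
        LinearMap.pi (fun l => ∑ j, B l j • f j) ∘ₗ s = σ • LinearMap.id ∧
        (∃ j, v j ∉ p.asIdeal) ∧ ∀ l, ∑ j, B l j * v j ∈ p.asIdeal := by
    intro p hp
    obtain ⟨hpX, d, hd, hdn, -⟩ := hbad.mem_toFinset.1 hp
    obtain ⟨h, hh, hsplit⟩ := (H p hpX d hd).mono (j := t + d) le_rfl
      (by simp only [le_min_iff]; omega)
    obtain ⟨σ, ⟨s, hs⟩, hσ⟩ := SetLike.not_le_iff_exists.1 hsplit
    obtain ⟨B, hB⟩ := exists_sum_smul_of_forall_mem_span hh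
    obtain ⟨v, hv, hBv⟩ := exists_mulVec_mem_prime (by omega : t + d < n + 1) B p
    exact ⟨d, hd, B, s, σ, v, hσ, by rw [← hs, funext hB], hv, hBv⟩
  choose d hd B s σ v hσ hs hv hBv using hdata
  -- The last coordinate of the kernel vector once `f (Fin.last n)` is replaced by `g`; `b` is
  -- chosen to make it nonzero modulo every bad prime.
  let w (b : Fin n → R) (p) (hp : p ∈ hbad.toFinset) : R :=
    ∑ i : Fin n, b i * v p hp i.castSucc + v p hp (Fin.last n)
  obtain ⟨b, hb⟩ := exists_forall_of_finset_primes
    (fun p (b : Fin n → R) => ∀ hp : p ∈ hbad.toFinset, w b p hp ∉ p.asIdeal) hbad.toFinset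
    (by
      intro p _ x y hxy hx hp hy
      apply hx hp
      have : w x p hp = ∑ i, (x i - y i) * v p hp i.castSucc + w y p hp := by
        simp only [w, sub_mul, Finset.sum_sub_distrib]
        ring
      rw [this]
      exact p.asIdeal.add_mem
        (p.asIdeal.sum_mem fun i _ => p.asIdeal.mul_mem_right _ (hxy i)) hy)
    (by
      intro p hp a c hc
      by_cases ha : w a p hp ∈ p.asIdeal
      · obtain ⟨i, hi⟩ : ∃ i : Fin n, v p hp i.castSucc ∉ p.asIdeal := by
          by_contra! hcon
          obtain ⟨j, hj⟩ := hv p hp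
          induction j using Fin.lastCases with
          | last =>
            refine hj ((p.asIdeal.add_mem_iff_right ?_).1 ha)
            exact p.asIdeal.sum_mem fun i _ => p.asIdeal.mul_mem_left _ (hcon i)
          | cast i => exact hj (hcon i)
        refine ⟨Pi.single i 1, fun _ hmem => p.2.mul_notMem hc hi ?_⟩
        have : w (a + c • Pi.single i 1) p hp = w a p hp + c * v p hp i.castSucc := by
          simp [w, add_mul, Finset.sum_add_distrib, Pi.single_apply]
          ring
        rw [this] at hmem
        exact (p.asIdeal.add_mem_iff_right ha).1 hmem
      · exact ⟨0, fun _ => by simpa using ha⟩)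
  let g : M →ₗ[A] N := f (Fin.last n) + ∑ i : Fin n, b i • f i.castSucc
  let q (p) (hp : p ∈ hbad.toFinset) : Fin (t + d p hp) → R := fun l => B p hp l (Fin.last n)
  -- The columns of `B` rewritten in terms of the generators `f i.castSucc` and `g`.
  let Q (p) (hp : p ∈ hbad.toFinset) : Matrix (Fin (t + d p hp)) (Fin n) R :=
    fun l i => B p hp l i.castSucc - b i * q p hp l
  have hQ : ∀ p hp l, ∑ i, Q p hp l i • f i.castSucc + q p hp l • g = ∑ j, B p hp l j • f j := by
    intro p hp l
    rw [Fin.sum_univ_castSucc]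
    simp only [Q, g, q, sub_smul, Finset.sum_sub_distrib, smul_add, Finset.smul_sum, smul_smul,
      mul_comm (b _)]
    abel
  have hQv : ∀ p hp l, ∑ i, Q p hp l i * v p hp (Fin.castSucc i) + q p hp l * w b p hp
      = ∑ j, B p hp l j * v p hp j := by
    intro p hp l
    rw [Fin.sum_univ_castSucc]
    simp only [Q, w, q, sub_mul, Finset.sum_sub_distrib, mul_add, Finset.mul_sum]
    have : ∀ i : Fin n, b i * B p hp l (Fin.last n) * v p hp i.castSucc
      = B p hp l (Fin.last n) * (b i * v p hp i.castSucc) := fun i => by ring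
    simp only [this]
    ring
  obtain ⟨a, ha⟩ := exists_forall_of_finset_primes
    (fun p (a : Fin n → R) => ∀ hp : p ∈ hbad.toFinset, ¬ splitIdeal R
      (LinearMap.pi (fun l => ∑ i, Q p hp l i • (f (Fin.castSucc i) + a i • g)) ∘ₗ s p hp)
        ≤ p.asIdeal) hbad.toFinset
    (by
      intro p _ x y hxy hx hp
      refine splitIdeal_pi_comp_not_le_congr (s p hp) _ _ g
        (fun l => ∑ i, Q p hp l i * (x i - y i))
        (fun l => p.asIdeal.sum_mem fun i _ => p.asIdeal.mul_mem_left _ (hxy i)) (fun l => ?_)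
        (hx hp)
      rw [Finset.sum_smul, ← Finset.sum_add_distrib]
      refine Finset.sum_congr rfl fun i _ => ?_
      module)
    (by
      intro p hp a c hc
      obtain ⟨r, hr⟩ := exists_smul_add_splitIdeal_not_le (fun i => f (Fin.castSucc i)) g
        (Q p hp) (q p hp) (s p hp) (hσ p hp) (by simp only [hQ]; exact hs p hp)
        (fun i => v p hp (Fin.castSucc i)) (hb p hp hp)
        (fun l => by rw [hQv]; exact hBv p hp l) a hc
      exact ⟨r, fun _ => hr⟩)
  let f' : Fin n → (M →ₗ[A] N) := fun i => f i.castSucc + a i • g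
  have hfF : ∀ j, f j ∈ F := fun j => Submodule.subset_span ⟨j, rfl⟩
  have hgF : g ∈ F := F.add_mem (hfF _) (F.sum_mem fun i _ => F.smul_mem _ (hfF _))
  have hle : F ≤ Submodule.span R (Set.range f') ⊔ R ∙ g := by
    have hg : g ∈ Submodule.span R (Set.range f') ⊔ R ∙ g :=
      Submodule.mem_sup_right (Submodule.mem_span_singleton_self g)
    have hcs : ∀ i : Fin n, f i.castSucc ∈ Submodule.span R (Set.range f') ⊔ R ∙ g := fun i => by
      have : f i.castSucc = f' i - a i • g := by simp [f']
      rw [this]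
      exact Submodule.sub_mem _ (Submodule.mem_sup_left (Submodule.subset_span ⟨i, rfl⟩))
        (Submodule.smul_mem _ _ hg)
    refine Submodule.span_le.2 ?_
    rintro _ ⟨j, rfl⟩
    induction j using Fin.lastCases with
    | last =>
      have : f (Fin.last n) = g - ∑ i : Fin n, b i • f i.castSucc := by simp [g]
      rw [this]
      exact Submodule.sub_mem _ hg
        (Submodule.sum_mem _ fun i _ => Submodule.smul_mem _ _ (hcs i))
    | cast i => exact hcs i
  refine ⟨f', fun i => F.add_mem (hfF _) (F.smul_mem _ hgF), fun p hpX e he => ?_⟩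
  -- If the target is capped at `n`, or if there is a split `(t + e + 1)`-tuple, one element may be
  -- lost; otherwise `p` is bad and the choice of `a` applies.
  rcases Nat.lt_or_ge n (t + e) with hlt | hge
  · exact (HasSplitTuple.of_le_sup_span_singleton hle
      ((H p hpX e he).mono le_rfl (by simp only [le_min_iff]; omega))).mono le_rfl (min_le_left _ _)
  · by_cases hp : HasSplitTuple p F (t + e + 1)
    · exact (HasSplitTuple.of_le_sup_span_singleton hle hp).mono le_rfl (min_le_right _ _)
    · have hpb : p ∈ hbad.toFinset := hbad.mem_toFinset.2 ⟨hpX, e, he, hge, hp⟩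
      have hde : d p hpb = e := by
        have := (hd p hpb).symm.trans he
        exact_mod_cast this
      have : HasSplitTuple p (Submodule.span R (Set.range f')) (t + d p hpb) :=
        ⟨_, fun l => Submodule.sum_mem _ fun i _ => Submodule.smul_mem _ _
            (Submodule.subset_span ⟨i, rfl⟩),
          fun hle => ha p hpb hpb ((splitIdeal_comp_le _ _).trans hle)⟩
      rw [hde] at this
      exact this.mono le_rfl (min_le_right _ _)

lemma exists_tuple_splitIdeal_not_le {X : Set (PrimeSpectrum R)} (hX : IsBasicSet X)
    (hdim : topologicalKrullDim X < ⊤) {t n : ℕ} (htn : t ≤ n) (f : Fin n → (M →ₗ[A] N))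
    (H : ∀ p ∈ X, ∀ d : ℕ, dimAt X p = d →
      HasSplitTuple p (Submodule.span R (Set.range f)) (min n (t + d))) :
    ∃ f' : Fin t → (M →ₗ[A] N), (∀ i, f' i ∈ Submodule.span R (Set.range f)) ∧
      ∀ p ∈ X, ¬ splitIdeal R (LinearMap.pi f') ≤ p.asIdeal := by
  induction n, htn using Nat.le_induction with
  | base =>
    refine ⟨f, fun i => Submodule.subset_span ⟨i, rfl⟩, fun p hp => ?_⟩
    obtain ⟨d, hd⟩ := exists_nat_dimAt hdim hp
    exact splitIdeal_pi_not_le_of_hasSplitTuple ((H p hp d hd).mono le_rfl (by simp))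
  | succ n _ ih =>
    obtain ⟨f', hf', H'⟩ := exists_tuple_succ hX hdim f H
    obtain ⟨f'', hf'', H''⟩ := ih f' H'
    refine ⟨f'', fun i => Submodule.span_le.2 ?_ (hf'' i), H''⟩
    rintro _ ⟨j, rfl⟩
    exact hf' j

/-- A finitely generated `F` with `t + dim_X(p)` split elements at each `p ∈ X` contains a `t`-tuple
that splits at every `p ∈ X`. -/
lemma exists_mem_splitIdeal_not_le {X : Set (PrimeSpectrum R)} (hX : IsBasicSet X)
    (hdim : topologicalKrullDim X < ⊤) {F : Submodule R (M →ₗ[A] N)} (hF : F.FG) {t : ℕ}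
    (H : ∀ p ∈ X, ∀ d : ℕ, dimAt X p = d → HasSplitTuple p F (t + d)) :
    ∃ f : Fin t → (M →ₗ[A] N), (∀ i, f i ∈ F) ∧
      ∀ p ∈ X, ¬ splitIdeal R (LinearMap.pi f) ≤ p.asIdeal := by
  obtain ⟨n, f, rfl⟩ := Submodule.fg_iff_exists_fin_generating_family.1 hF
  -- Padding with `t` zeros ensures that there are at least `t` generators to start from.
  let f₀ : Fin (n + t) → (M →ₗ[A] N) := Fin.append f 0
  have h1 : Submodule.span R (Set.range f) ≤ Submodule.span R (Set.range f₀) :=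
    Submodule.span_mono (by
      rintro _ ⟨i, rfl⟩
      exact ⟨Fin.castAdd t i, by simp [f₀]⟩)
  have h2 : Submodule.span R (Set.range f₀) ≤ Submodule.span R (Set.range f) := by
    refine Submodule.span_le.2 ?_
    rintro _ ⟨i, rfl⟩
    induction i using Fin.addCases with
    | left i =>
      simp only [f₀, Fin.append_left]
      exact Submodule.subset_span ⟨i, rfl⟩
    | right i => simp [f₀]
  obtain ⟨f', hf', H'⟩ := exists_tuple_splitIdeal_not_le hX hdim (Nat.le_add_left t n) f₀
    (fun p hp d hd => (H p hp d hd).mono h1 (min_le_right _ _))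
  exact ⟨f', fun i => h2 (hf' i), H'⟩

end Tuples

/-! ### Extension from `L` to `M` and passage to the invariants `δ` -/

section Main

variable {R : Type*} [CommRing R] {S : Type*} [Ring S] [Algebra R S] [Module.Finite R S]
  {M : Type*} [AddCommGroup M] [Module R M] [Module Sᵐᵒᵖ M] [IsScalarTower R Sᵐᵒᵖ M]
  {N : Type*} [AddCommGroup N] [Module R N] [Module Sᵐᵒᵖ N] [IsScalarTower R Sᵐᵒᵖ N]
  [Module.FinitePresentation Sᵐᵒᵖ N]

lemma hasSplitTuple_of_le_deltaAt {p : PrimeSpectrum R} {F : Submodule R (M →ₗ[Sᵐᵒᵖ] N)} {j : ℕ}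
    (H : (j : ℕ∞) ≤ deltaAt p F) : HasSplitTuple p F j := by
  have : Module.Finite R N := Module.Finite.trans Sᵐᵒᵖ N
  rcases j with _ | j
  · refine ⟨fun _ => 0, fun _ => F.zero_mem, fun hle => p.2.ne_top ?_⟩
    exact p.asIdeal.eq_top_iff_one.2 (hle ⟨0, Subsingleton.elim _ _⟩)
  -- A strict bound extracts a witness from the supremum even when it is infinite; hence the
  -- separate case of the empty tuple.
  · have hlt : (j : ℕ∞) < deltaAt p F := lt_of_lt_of_le (by exact_mod_cast j.lt_succ_self) H
    obtain ⟨k, hk⟩ := lt_iSup_iff.1 hlt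
    obtain ⟨⟨h, hh, hs⟩, hjk⟩ := lt_iSup_iff.1 hk
    have hk : HasSplitTuple p F k := ⟨h, hh, splitIdeal_not_le_of_isSplitSurjectiveAt hs⟩
    exact hk.mono le_rfl (by exact_mod_cast hjk)

lemma exists_extension_splitIdeal_not_le (L : Submodule Sᵐᵒᵖ M)
    (F : Submodule R (L →ₗ[Sᵐᵒᵖ] N)) (hF : F.FG) (G : Submodule R (M →ₗ[Sᵐᵒᵖ] N))
    (hFG : ∀ f ∈ F, ∃ g ∈ G, g ∘ₗ L.subtype = f)
    {X : Set (PrimeSpectrum R)} (hX : IsBasicSet X) (hdim : topologicalKrullDim X < ⊤) {t : ℕ}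
    (H : ∀ p ∈ X, (t : WithBot ℕ∞) + dimAt X p ≤ ((deltaAt p F : ℕ∞) : WithBot ℕ∞)) :
    ∃ g : Fin t → (M →ₗ[Sᵐᵒᵖ] N), (∀ i, g i ∈ G) ∧
      ∀ p ∈ X, ¬ splitIdeal R (LinearMap.pi g) ≤ p.asIdeal := by
  have : Module.Finite R N := Module.Finite.trans Sᵐᵒᵖ N
  obtain ⟨f, hf, hsplit⟩ := exists_mem_splitIdeal_not_le hX hdim hF (t := t) (fun p hp d hd => by
    refine hasSplitTuple_of_le_deltaAt ?_
    have := H p hp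
    rw [hd] at this
    exact_mod_cast this)
  choose g hgG hg using fun i => hFG (f i) (hf i)
  refine ⟨g, hgG, fun p hp hle => hsplit p hp ?_⟩
  have : LinearMap.pi f = LinearMap.pi g ∘ₗ L.subtype :=
    LinearMap.ext fun x => funext fun i => (LinearMap.congr_fun (hg i) x).symm
  rw [this]
  exact (splitIdeal_comp_le _ _).trans hle

/-- Some `σ ∉ p` kills `N`, so `σ • id = 0` factors through any map. This covers the maximal ideals
outside `X` in part (2). -/
lemma splitIdeal_not_le_of_notMem_support {p : PrimeSpectrum R} (hp : p ∉ Module.support R N)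
    {t : ℕ} (g : Fin t → (M →ₗ[Sᵐᵒᵖ] N)) : ¬ splitIdeal R (LinearMap.pi g) ≤ p.asIdeal := by
  have : Module.Finite R N := Module.Finite.trans Sᵐᵒᵖ N
  rw [Module.mem_support_iff_of_finite, SetLike.not_le_iff_exists] at hp
  obtain ⟨σ, hσN, hσ⟩ := hp
  refine fun hle => hσ (hle ⟨0, LinearMap.ext fun x => funext fun i => ?_⟩)
  simpa using (Module.mem_annihilator.1 hσN (x i)).symm

lemma toExt_coe (n : ℕ∞) : toExt (n : WithBot ℕ∞) = ((n : ℝ≥0∞) : EReal) := rfl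

lemma add_le_of_lt_toExt_sub {n d : ℕ} {δ : ℕ∞}
    (h : toExt ((n : ℕ∞) : WithBot ℕ∞) < toExt δ - toExt ((d : ℕ∞) : WithBot ℕ∞)) :
    ((n + 1 : ℕ) : ℕ∞) + d ≤ δ := by
  induction δ using ENat.recTopCoe with
  | top => exact le_top
  | coe δ =>
    simp only [toExt_coe, ENat.toENNReal_coe] at h
    have h' : (((n : ℝ) : EReal)) < (((δ : ℝ) - (d : ℝ) : ℝ) : EReal) := by
      have hc : ∀ k : ℕ, (((k : ℝ≥0∞)) : EReal) = ((k : ℝ) : EReal) := fun k => by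
        rw [← ENNReal.ofReal_natCast, EReal.coe_ennreal_ofReal, max_eq_left k.cast_nonneg]
      rwa [hc, hc, hc, ← EReal.coe_sub] at h
    have h2 : (n : ℝ) + d < δ := by
      have := EReal.coe_lt_coe_iff.1 h'
      linarith
    have h3 : n + d < δ := by exact_mod_cast h2
    exact_mod_cast (by omega : n + 1 + d ≤ δ)

end Main

end SplittingCapacity
end

theorem mainTheorem8
    {R : Type*} [CommRing R] {S : Type*} [Ring S] [Algebra R S] [Module.Finite R S]
    {M : Type*} [AddCommGroup M] [Module R M] [Module Sᵐᵒᵖ M] [IsScalarTower R Sᵐᵒᵖ M]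
    {N : Type*} [AddCommGroup N] [Module R N] [Module Sᵐᵒᵖ N] [IsScalarTower R Sᵐᵒᵖ N]
    [Module.FinitePresentation Sᵐᵒᵖ N]
    (L : Submodule Sᵐᵒᵖ M)
    (F : Submodule R (L →ₗ[Sᵐᵒᵖ] N)) (hF : F.FG)
    (G : Submodule R (M →ₗ[Sᵐᵒᵖ] N))
    (hFG : ∀ f ∈ F, ∃ g ∈ G, g ∘ₗ L.subtype = f)
    (X : Set (PrimeSpectrum R)) (hXN : X ⊆ Module.support R N)
    (hX : SplittingCapacity.IsBasicSet X) (hdim : topologicalKrullDim X < ⊤) :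
    (∀ t : ℕ, 0 < t →
      (∀ p ∈ X, (t : WithBot ℕ∞) + SplittingCapacity.dimAt X p
        ≤ ((SplittingCapacity.deltaAt p F : ℕ∞) : WithBot ℕ∞)) →
      ∃ g : Fin t → (M →ₗ[Sᵐᵒᵖ] N), (∀ i, g i ∈ G) ∧
        ∀ p ∈ X, SplittingCapacity.IsSplitSurjectiveAt p (LinearMap.pi g)) ∧
    ({p : PrimeSpectrum R | p.asIdeal.IsMaximal} ∩ Module.support R N ⊆ X →
      ⨅ p ∈ X, (SplittingCapacity.toExt (SplittingCapacity.deltaAt p F)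
          - SplittingCapacity.toExt (SplittingCapacity.dimAt X p))
        ≤ SplittingCapacity.toExt (SplittingCapacity.delta G)) := by
  open SplittingCapacity in
  refine ⟨fun t _ H => ?_, fun hmax => ?_⟩
  · obtain ⟨g, hg, hsplit⟩ := exists_extension_splitIdeal_not_le L F hF G hFG hX hdim H
    exact ⟨g, hg, fun p hp => isSplitSurjectiveAt_of_splitIdeal_not_le (hsplit p hp)⟩
  · rcases eq_or_ne (delta G) ⊤ with htop | hne
    · rw [htop, toExt_coe]
      simp
    obtain ⟨n, hn⟩ := ENat.ne_top_iff_exists.1 hne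
    by_contra! hlt
    rw [← hn] at hlt
    -- If `δ(G) = n` were below the infimum, integrality would give `δ_p(F) ≥ n + 1 + dim_X p` on
    -- `X`, and the local result with `t = n + 1` would produce a split tuple in `G` that is too
    -- long.
    obtain ⟨g, hg, hsplit⟩ := exists_extension_splitIdeal_not_le L F hF G hFG hX hdim
      (t := n + 1) (fun p hp => by
        obtain ⟨d, hd⟩ := exists_nat_dimAt hdim hp
        have h := hlt.trans_le (iInf₂_le p hp)
        rw [hd] at h ⊢
        exact_mod_cast add_le_of_lt_toExt_sub h)
    have hs : IsSplitSurjective (LinearMap.pi g) :=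
      isSplitSurjective_of_forall_isMaximal (R := R) _ fun m hm => by
        by_cases hN : (⟨m, hm.isPrime⟩ : PrimeSpectrum R) ∈ Module.support R N
        · exact hsplit ⟨m, hm.isPrime⟩ (hmax ⟨hm, hN⟩)
        · exact splitIdeal_not_le_of_notMem_support hN g
    have hle : ((n + 1 : ℕ) : ℕ∞) ≤ delta G :=
      le_iSup₂_of_le (n + 1) ⟨g, hg, hs⟩ le_rfl
    rw [← hn] at hle
    have : n + 1 ≤ n := by exact_mod_cast hle
    omega
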